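/- Let $A_0$ be an arbitrary countably infinite set and let $\mathcal G_0$ be the group of all permutations of $A_0$. By induction on $n\in\mathbb N$ put $$A_{n+1}:=A_n\,\dot\cup\,\{(n+1,p,\varepsilon): p\in A_n\times A_n,\ \varepsilon\in\{0,1\}\},$$ and let $\mathcal G_{n+1}$ be the group of all permutations $h$ of $A_{n+1}$ for which there are $g\in\mathcal G_n$ and $\delta\in\{0,1\}$ such that $h(x)=g(x)$ for all $x\in A_n$ and $h\big((n+1,\langle x,y\rangle,\varepsilon)\big)=(n+1,\langle g(x),g(y)\rangle,\delta+\varepsilon \bmod 2)$ for all $x,y\in A_n$ and $\varepsilon\in\{0,1\}$. Let $A:=\bigcup_{n\in\mathbb N}A_n$ and let $\mathcal G$ be the group of all permutations $H$ of $A$ with $H|_{A_n}\in\mathcal G_n$ for all $n\in\mathbb N$. Work in the universe of set theory with atoms (ZFA) whose set of atoms is $A$; every permutation of $A$ acts on this universe by $\pi x=\{\pi y:y\in x\}$ for sets $x$. Let $\mathcal F$ be the normal filter of subgroups of $\mathcal G$ generated by the groups $\mathrm{Fix}_{\mathcal G}(E)=\{\pi\in\mathcal G:\pi e=e\text{ for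 all }e\in E\}$ with $E\subseteq A$ finite. An object $x$ is symmetric if $\{\pi\in\mathcal G:\pi x=x\}\in\mathcal F$. Let $\mathcal V_p$ be the permutation model that consists of all hereditarily symmetric objects, that is, of the symmetric objects all of whose elements are again hereditarily symmetric. In $\mathcal V_p$, the cardinality of a set $m$ is the set of all sets $x$ that admit a bijection onto $m$ and lie in $\mathcal P^\alpha(A)$, where $\alpha$ is the least ordinal for which there is such an $x$; here $\mathcal P^0(A)=A$, $\mathcal P^{\alpha+1}(A)=\mathcal P^\alpha(A)\cup\mathcal P(\mathcal P^\alpha(A))$, and unions are taken at limits. For cardinals, $\mathfrak p\le\mathfrak q$ means that for all $x\in\mathfrak p$ and $y\in\mathfrak q$ there is a one-to-one mapping from $x$ into $y$, and $\mathfrak p<\mathfrak q$ means $\mathfrak p\le\mathfrak q$ and $\mathfrak p\ne\mathfrak q$. Let $\mathfrak m$ denote the cardinality of the set $A$ of atoms of $\mathcal V_p$, let $\mathfrak m^2$ denote the cardinality of $A\times A$, and let $[\mathfrak m]^2$ denote the cardinality of the set $[A]^2$ of all two-element subsets of $A$. Then $$\mathcal V_p\models \mathfrak m^2<[\mathfrak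 m]^2 .$$ -/

import Mathlib

universe u

namespace PermutationModel

/-! ### The universe of sets over a type `A` of atoms -/

/-- Codes for the objects of the cumulative hierarchy over the atoms `A`: an atom, or a
(small) indexed family of objects. -/
inductive PreUniv (A : Type u) : Type (u + 1)
  | atom : A → PreUniv A
  | set : (ι : Type u) → (ι → PreUniv A) → PreUniv A

namespace PreUniv

variable {A : Type u}

/-- Extensional equality of codes. Atoms are equal only to themselves, never to a set. -/
def Equiv : PreUniv A → PreUniv A → Prop
  | atom a, atom b => a = b
  | set _ f, set _ g => (∀ i, ∃ j, Equiv (f i) (g j)) ∧ (∀ j, ∃ i, Equiv (f i) (g j))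
  | atom _, set _ _ => False
  | set _ _, atom _ => False

theorem Equiv.refl : ∀ x : PreUniv A, Equiv x x
  | atom _ => rfl
  | set _ f => ⟨fun i => ⟨i, Equiv.refl (f i)⟩, fun i => ⟨i, Equiv.refl (f i)⟩⟩

theorem Equiv.symm : ∀ {x y : PreUniv A}, Equiv x y → Equiv y x
  | atom _, atom _, h => Eq.symm h
  | set _ _, set _ _, h =>
    ⟨fun j => let ⟨i, hi⟩ := h.2 j; ⟨i, Equiv.symm hi⟩,
      fun i => let ⟨j, hj⟩ := h.1 i; ⟨j, Equiv.symm hj⟩⟩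
  | atom _, set _ _, h => False.elim h
  | set _ _, atom _, h => False.elim h

theorem Equiv.trans : ∀ {x y z : PreUniv A}, Equiv x y → Equiv y z → Equiv x z
  | atom _, atom _, atom _, h, k => Eq.trans h k
  | set _ _, set _ _, set _ _, h, k =>
    ⟨fun i => let ⟨j, hj⟩ := h.1 i; let ⟨l, hl⟩ := k.1 j; ⟨l, Equiv.trans hj hl⟩,
      fun l => let ⟨j, hj⟩ := k.2 l; let ⟨i, hi⟩ := h.2 j; ⟨i, Equiv.trans hi hj⟩⟩
  | atom _, set _ _, _, h, _ => False.elim h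
  | set _ _, atom _, _, h, _ => False.elim h
  | atom _, atom _, set _ _, _, k => False.elim k
  | set _ _, set _ _, atom _, _, k => False.elim k

instance setoid (A : Type u) : Setoid (PreUniv A) :=
  ⟨Equiv, Equiv.refl, Equiv.symm, Equiv.trans⟩

/-- `Mem y x`: the object coded by `y` is an element of the object coded by `x`. Atoms have no
elements. -/
def Mem (y : PreUniv A) : PreUniv A → Prop
  | atom _ => False
  | set _ f => ∃ i, Equiv y (f i)

theorem Mem.congr {y y' x x' : PreUniv A} (hy : Equiv y y') (hx : Equiv x x') :
    Mem y x ↔ Mem y' x' := by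
  have key : ∀ {y y' x x' : PreUniv A}, Equiv y y' → Equiv x x' → Mem y x → Mem y' x' := by
    intro y y' x x' hy hx h
    cases x with
    | atom a => exact h.elim
    | set ι f =>
      cases x' with
      | atom a => exact False.elim hx
      | set κ g =>
        obtain ⟨i, hi⟩ := h
        obtain ⟨j, hj⟩ := hx.1 i
        exact ⟨j, hy.symm.trans (hi.trans hj)⟩
  exact ⟨key hy hx, key hy.symm hx.symm⟩

/-- The code is that of an atom. -/
def IsAtom : PreUniv A → Prop
  | atom _ => True
  | set _ _ => False

theorem IsAtom.congr : ∀ {x y : PreUniv A}, Equiv x y → (IsAtom x ↔ IsAtom y)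
  | atom _, atom _, _ => Iff.rfl
  | set _ _, set _ _, _ => Iff.rfl
  | atom _, set _ _, h => False.elim h
  | set _ _, atom _, h => False.elim h

/-- A permutation of the atoms acts on all codes. -/
def act (π : Equiv.Perm A) : PreUniv A → PreUniv A
  | atom a => atom (π a)
  | set ι f => set ι fun i => act π (f i)

theorem act_equiv (π : Equiv.Perm A) : ∀ {x y : PreUniv A}, Equiv x y → Equiv (act π x) (act π y)
  | atom _, atom _, h => congrArg π h
  | set _ _, set _ _, h =>
    ⟨fun i => let ⟨j, hj⟩ := h.1 i; ⟨j, act_equiv π hj⟩,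
      fun j => let ⟨i, hi⟩ := h.2 j; ⟨i, act_equiv π hi⟩⟩
  | atom _, set _ _, h => False.elim h
  | set _ _, atom _, h => False.elim h

theorem act_one : ∀ x : PreUniv A, act 1 x = x
  | atom _ => rfl
  | set ι f => congrArg (set ι) (funext fun i => act_one (f i))

theorem act_mul (π σ : Equiv.Perm A) : ∀ x : PreUniv A, act (π * σ) x = act π (act σ x)
  | atom _ => rfl
  | set ι f => congrArg (set ι) (funext fun i => act_mul π σ (f i))

end PreUniv

/-- The universe of set theory with atoms whose atoms are the elements of `A`. -/
def Univ (A : Type u) : Type (u + 1) := Quotient (PreUniv.setoid A)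

namespace Univ

variable {A : Type u}

/-- An element of `A`, as an object of the universe. -/
def atom (a : A) : Univ A := Quotient.mk _ (PreUniv.atom a)

instance : Membership (Univ A) (Univ A) where
  mem x y := Quotient.lift₂ PreUniv.Mem
    (fun _ _ _ _ hy hx => propext (PreUniv.Mem.congr hy hx)) y x

/-- The object is an atom. -/
def IsAtom : Univ A → Prop :=
  Quotient.lift PreUniv.IsAtom fun _ _ h => propext (PreUniv.IsAtom.congr h)

/-- A permutation `π` of the atoms acts on the universe by `π x = {π y : y ∈ x}`. -/
instance : MulAction (Equiv.Perm A) (Univ A) where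
  smul π := Quotient.map (PreUniv.act π) fun _ _ h => PreUniv.act_equiv π h
  one_smul x := Quotient.inductionOn x fun x => congrArg (Quotient.mk _) (PreUniv.act_one x)
  mul_smul π σ x :=
    Quotient.inductionOn x fun x => congrArg (Quotient.mk _) (PreUniv.act_mul π σ x)

/-- The hierarchy `𝒫^α(A)`: the atoms at `0`, `𝒫^{α+1}(A) = 𝒫^α(A) ∪ 𝒫(𝒫^α(A))`, and unions at
limits. -/
noncomputable def cumul (A : Type u) (α : Ordinal.{u}) : Set (Univ A) :=
  Ordinal.limitRecOn α {x | x.IsAtom}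
    (fun _ P => P ∪ {x | ¬ x.IsAtom ∧ ∀ y ∈ x, y ∈ P})
    (fun γ _ P => {x | ∃ (β : Ordinal.{u}) (h : β < γ), x ∈ P β h})

end Univ

/-! ### Permutation models -/

section Models

variable {A : Type u}

/-- Normal filters on a group `G` of permutations of `A`. -/
structure IsNormalFilter (G : Subgroup (Equiv.Perm A)) (F : Set (Subgroup G)) : Prop where
  top_mem : ⊤ ∈ F
  mono : ∀ H K : Subgroup G, H ∈ F → H ≤ K → K ∈ F
  inf_mem : ∀ H K : Subgroup G, H ∈ F → K ∈ F → H ⊓ K ∈ F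
  conj_mem : ∀ (π : G) (H : Subgroup G), H ∈ F → H.map (MulAut.conj π).toMonoidHom ∈ F
  stabilizer_mem : ∀ a : A, MulAction.stabilizer G a ∈ F

/-- The filter of all subgroups of `G` that contain `Fix_G(E) = {π ∈ G : π e = e for e ∈ E}` for
some finite `E ⊆ A`. -/
def finiteSupportFilter (G : Subgroup (Equiv.Perm A)) : Set (Subgroup G) :=
  {K | ∃ E : Set A, E.Finite ∧ fixingSubgroup G E ≤ K}

/-- `finiteSupportFilter G` is the normal filter on `G` generated by the groups `Fix_G(E)` with
`E ⊆ A` finite. -/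
theorem finiteSupportFilter_isLeast (G : Subgroup (Equiv.Perm A)) :
    IsLeast {F | IsNormalFilter G F ∧ ∀ E : Set A, E.Finite → fixingSubgroup G E ∈ F}
      (finiteSupportFilter G) := by
  refine ⟨⟨⟨?_, ?_, ?_, ?_, ?_⟩, fun E hE => ⟨E, hE, le_rfl⟩⟩, ?_⟩
  · exact ⟨∅, Set.finite_empty, le_top⟩
  · rintro H K ⟨E, hE, h⟩ hHK
    exact ⟨E, hE, h.trans hHK⟩
  · rintro H K ⟨E, hE, h⟩ ⟨E', hE', h'⟩
    refine ⟨E ∪ E', hE.union hE', le_inf ?_ ?_⟩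
    · exact (fixingSubgroup_antitone G A Set.subset_union_left).trans h
    · exact (fixingSubgroup_antitone G A Set.subset_union_right).trans h'
  · rintro π H ⟨E, hE, h⟩
    refine ⟨(fun a => π • a) '' E, hE.image _, ?_⟩
    intro σ hσ
    refine ⟨π⁻¹ * σ * π, h ?_, by simp [mul_assoc]⟩
    rw [mem_fixingSubgroup_iff] at hσ ⊢
    intro e he
    rw [mul_smul, mul_smul, hσ _ ⟨e, he, rfl⟩, inv_smul_smul]
  · intro a
    refine ⟨{a}, Set.finite_singleton a, fun σ hσ => ?_⟩
    rw [mem_fixingSubgroup_iff] at hσ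
    exact hσ a rfl
  · rintro F ⟨hF, hE⟩ K ⟨E, hfin, hK⟩
    exact hF.mono _ _ (hE E hfin) hK

/-- `x` is hereditarily symmetric: `Sym_G(x) = {π ∈ G : π x = x}` belongs to `F`, and every
element of `x` is hereditarily symmetric. -/
inductive HereditarilySymmetric (G : Subgroup (Equiv.Perm A)) (F : Set (Subgroup G)) :
    Univ A → Prop
  | intro (x : Univ A) (hx : MulAction.stabilizer G x ∈ F)
      (h : ∀ y ∈ x, HereditarilySymmetric G F y) : HereditarilySymmetric G F x

/-- The class of all hereditarily symmetric objects. -/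
def permutationModel (G : Subgroup (Equiv.Perm A)) (F : Set (Subgroup G)) : Set (Univ A) :=
  {x | HereditarilySymmetric G F x}

end Models

/-! ### Notions of set theory with atoms, interpreted in a structure

Below, `V` is a structure for the language of set theory with atoms, and all quantifiers range
over `V`: each notion is evaluated inside the structure. -/

/-- Structures for the language with a binary relation `∈` and a predicate for the atoms. -/
class AtomStructure (V : Type*) extends Membership V V where
  /-- The predicate for the atoms. -/
  IsAtom : V → Prop

/-- A class of objects of the universe, with the membership relation and atoms of the universe. -/
instance {A : Type u} (V : Set (Univ A)) : AtomStructure V where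
  mem x y := y.1 ∈ x.1
  IsAtom x := x.1.IsAtom

section Internal

variable {V : Type*} [AtomStructure V]

/-- `x` is a set (not an atom). -/
def IsSet (x : V) : Prop := ¬ AtomStructure.IsAtom x

/-- `z = {x, y}`. -/
def IsUnorderedPair (z x y : V) : Prop := IsSet z ∧ ∀ w, w ∈ z ↔ w = x ∨ w = y

/-- `z = ⟨x, y⟩ = {{x}, {x, y}}`. -/
def IsOrderedPair (z x y : V) : Prop :=
  ∃ s t : V, IsUnorderedPair s x x ∧ IsUnorderedPair t x y ∧ IsUnorderedPair z s t

/-- `a` is the set of all atoms. -/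
def IsSetOfAtoms (a : V) : Prop := IsSet a ∧ ∀ w, w ∈ a ↔ AtomStructure.IsAtom w

/-- `z = x × y`. -/
def IsProduct (z x y : V) : Prop :=
  IsSet z ∧ ∀ w, w ∈ z ↔ ∃ u ∈ x, ∃ v ∈ y, IsOrderedPair w u v

/-- `z = [x]²`, the set of all two-element subsets of `x`. -/
def IsSetOfPairs (z x : V) : Prop :=
  IsSet z ∧ ∀ w, w ∈ z ↔ ∃ u ∈ x, ∃ v ∈ x, u ≠ v ∧ IsUnorderedPair w u v

/-- `⟨u, v⟩ ∈ f`. -/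
def Rel (f u v : V) : Prop := ∃ w ∈ f, IsOrderedPair w u v

/-- `f` is a function from `x` to `y`. -/
def IsFunction (f x y : V) : Prop :=
  IsSet f ∧ (∀ w ∈ f, ∃ u ∈ x, ∃ v ∈ y, IsOrderedPair w u v) ∧ ∀ u ∈ x, ∃! v, Rel f u v

/-- `f` is a one-to-one mapping from `x` into `y`. -/
def IsInjection (f x y : V) : Prop :=
  IsFunction f x y ∧ ∀ u u' v, Rel f u v → Rel f u' v → u = u'

/-- `f` is a one-to-one mapping from `x` onto `y`. -/
def IsBijection (f x y : V) : Prop :=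
  IsInjection f x y ∧ ∀ v ∈ y, ∃ u ∈ x, Rel f u v

/-- The class of all sets `x` of `V` for which `V` has a one-to-one mapping from `x` onto `m`. -/
def equinumerous (m : V) : Set V := {x | IsSet x ∧ ∃ f, IsBijection f x m}

/-- `𝔭 ≤ 𝔮`: for all `x ∈ 𝔭` and `y ∈ 𝔮`, `V` has a one-to-one mapping from `x` into `y`. -/
def CardLE (p q : Set V) : Prop := ∀ x ∈ p, ∀ y ∈ q, ∃ f, IsInjection f x y

/-- `𝔭 < 𝔮`: `𝔭 ≤ 𝔮` and `𝔭 ≠ 𝔮`. -/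
def CardLT (p q : Set V) : Prop := CardLE p q ∧ p ≠ q

end Internal

/-- The cardinality of `m` in the class `V`: all objects in `V` that are equinumerous to `m` in
`V` and lie in `𝒫^α(A)`, where `α` is the least ordinal for which there are such objects. -/
def cardinality {A : Type u} {V : Set (Univ A)} (m : V) : Set V :=
  {x | x ∈ equinumerous m ∧ ∃ α : Ordinal.{u},
    IsLeast {β | ∃ y ∈ equinumerous m, y.1 ∈ Univ.cumul A β} α ∧ x.1 ∈ Univ.cumul A α}

/-! ### The atoms that code pairs, and their group -/

/-- Formal tuples, from which the atoms are taken: `base a` is the element `a` of `A₀`, and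
`node n x y ε` is the tuple `(n, ⟨x, y⟩, ε)`. -/
inductive PreAtom (A₀ : Type u) : Type u
  | base : A₀ → PreAtom A₀
  | node : ℕ → PreAtom A₀ → PreAtom A₀ → ZMod 2 → PreAtom A₀

open PreAtom

variable {A₀ : Type u}

/-- `A_{n+1} = A_n ∪ {(n+1, p, ε) : p ∈ A_n × A_n, ε ∈ {0, 1}}`. -/
def level (A₀ : Type u) : ℕ → Set (PreAtom A₀)
  | 0 => Set.range base
  | n + 1 => level A₀ n ∪
      {t | ∃ x ∈ level A₀ n, ∃ y ∈ level A₀ n, ∃ ε : ZMod 2, t = node (n + 1) x y ε}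

/-- An element of `A_n`, as an element of `A_{n+1}`. -/
def level.lift {n : ℕ} (x : level A₀ n) : level A₀ (n + 1) := ⟨x.1, Or.inl x.2⟩

/-- The element `(n+1, ⟨x, y⟩, ε)` of `A_{n+1}`. -/
def level.node {n : ℕ} (x y : level A₀ n) (ε : ZMod 2) : level A₀ (n + 1) :=
  ⟨PreAtom.node (n + 1) x.1 y.1 ε, Or.inr ⟨x.1, x.2, y.1, y.2, ε, rfl⟩⟩

/-- `h` acts on `A_n` as `g`, and sends `(n+1, p, ε)` to `(n+1, g p, δ + ε)`. -/
def Extends {n : ℕ} (h : Equiv.Perm (level A₀ (n + 1))) (g : Equiv.Perm (level A₀ n))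
    (δ : ZMod 2) : Prop :=
  (∀ x, h (level.lift x) = level.lift (g x)) ∧
    ∀ x y ε, h (level.node x y ε) = level.node (g x) (g y) (δ + ε)

/-- The groups `G_n`: all permutations of `A_0`, and the permutations of `A_{n+1}` that extend
some `g ∈ G_n` with some `δ ∈ {0, 1}`. -/
def levelGroup (A₀ : Type u) : (n : ℕ) → Subgroup (Equiv.Perm (level A₀ n))
  | 0 => ⊤
  | n + 1 =>
    { carrier := {h | ∃ g ∈ levelGroup A₀ n, ∃ δ : ZMod 2, Extends h g δ}
      one_mem' := ⟨1, one_mem _, 0, fun _ => rfl, fun x y ε => by simp⟩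
      mul_mem' := by
        rintro h h' ⟨g, hg, δ, h1, h2⟩ ⟨g', hg', δ', h1', h2'⟩
        refine ⟨g * g', mul_mem hg hg', δ + δ', fun x => ?_, fun x y ε => ?_⟩
        · simp [h1, h1']
        · simp [h2, h2', add_assoc]
      inv_mem' := by
        rintro h ⟨g, hg, δ, h1, h2⟩
        refine ⟨g⁻¹, inv_mem hg, -δ, fun x => ?_, fun x y ε => ?_⟩
        · rw [Equiv.Perm.inv_eq_iff_eq, h1]; simp
        · rw [Equiv.Perm.inv_eq_iff_eq, h2]; simp [← add_assoc, CharTwo.add_self_eq_zero] }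

/-- The set of atoms `A = ⋃ n, A_n`. -/
abbrev Atom (A₀ : Type u) : Type u := {t : PreAtom A₀ // t ∈ ⋃ n, level A₀ n}

/-- An element of `A_n`, as an element of `A`. -/
def level.toAtom {n : ℕ} (x : level A₀ n) : Atom A₀ := ⟨x.1, Set.mem_iUnion.2 ⟨n, x.2⟩⟩

/-- The group of all permutations of `A` whose restriction to each `A_n` belongs to `G_n`. -/
def atomGroup (A₀ : Type u) : Subgroup (Equiv.Perm (Atom A₀)) where
  carrier := {H | ∀ n, ∃ g ∈ levelGroup A₀ n, ∀ x : level A₀ n, H (level.toAtom x) = level.toAtom (g x)}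
  one_mem' := fun n => ⟨1, one_mem _, fun _ => rfl⟩
  mul_mem' := by
    intro H H' h h' n
    obtain ⟨g, hg, e⟩ := h n
    obtain ⟨g', hg', e'⟩ := h' n
    exact ⟨g * g', mul_mem hg hg', fun x => by simp [e, e']⟩
  inv_mem' := by
    intro H h n
    obtain ⟨g, hg, e⟩ := h n
    refine ⟨g⁻¹, inv_mem hg, fun x => ?_⟩
    rw [Equiv.Perm.inv_eq_iff_eq, e]
    simp

/-- The permutation model `𝒱_p`. -/
def pairModel (A₀ : Type u) : Set (Univ (Atom A₀)) :=
  permutationModel (atomGroup A₀) (finiteSupportFilter (atomGroup A₀))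

end PermutationModel

/-!
# `𝔪² < [𝔪]²` in the model of atoms that code pairs

Every permutation in the group preserves the levels `A_n`, and hence also the least `n` with
`x, y ∈ A_n`. It maps `(n+1, ⟨x, y⟩, ε)` to `(n+1, ⟨π x, π y⟩, δ + ε)`, where `δ` does not depend
on `ε`. Hence `⟨x, y⟩ ↦ {(n+1, ⟨x, y⟩, 0), (n+1, ⟨x, y⟩, 1)}`, with `n` least, is an invariant
injection of `A × A` into `[A]²` (`smul_pairCode`, `pairCode_inj`), and it belongs to the model.

Conversely, let a bijection between `[A]²` and `A × A` have a finite support, and let `S ⊆ A₀` be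
the finite set of the elements of `A₀` from which the atoms of this support are built. Every
permutation of `A₀` that fixes `S` pointwise induces a permutation in the group
(`atomPerm_mem`) that preserves the bijection. Let `u, v ∈ A₀` lie outside `S` and let `{u, v}`
correspond to `⟨p, q⟩`. The transposition of `u` and `v` fixes `{u, v}`, hence also `p` and `q`,
so `u` does not occur in `p` or `q`. The transposition of `u` with a new element `w` then fixes
`⟨p, q⟩`, but maps `{u, v}` to `{w, v}`, which is a contradiction (`equinumerous_disjoint`).

To carry this out in the model, a relation that is invariant under the pointwise stabilizer of a
finite set of atoms is shown to have its graph in the model (`exists_graph`), and pairs and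
injections in the sense of the model are identified with those of the universe
(`isOrderedPair_iff`, `isInjection_iff`). Finally, `𝔪² ≠ [𝔪]²` follows because no set is
equinumerous to both `A × A` and `[A]²`, while the cardinal `𝔪²` is nonempty
(`cardinality_nonempty`).
-/

namespace PermutationModel

/-! ### Sets over the atoms as objects of the universe -/

namespace Univ

variable {A : Type u}

/-- The set `{f i : i ∈ ι}`, for a small family `f` of objects. -/
noncomputable def ofFamily {ι : Type u} (f : ι → Univ A) : Univ A :=
  Quotient.mk _ (PreUniv.set ι fun i => (f i).out)

theorem mem_ofFamily {ι : Type u} {f : ι → Univ A} {x : Univ A} :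
    x ∈ ofFamily f ↔ ∃ i, x = f i := by
  induction x using Quotient.inductionOn with
  | h x =>
    refine exists_congr fun i => ?_
    exact (Quotient.eq (r := PreUniv.setoid A)).symm.trans
      (Eq.congr_right (Quotient.out_eq (s := PreUniv.setoid A) (f i)))

theorem not_isAtom_ofFamily {ι : Type u} (f : ι → Univ A) : ¬ (ofFamily f).IsAtom := id

theorem isAtom_iff {x : Univ A} : x.IsAtom ↔ ∃ a, x = atom a := by
  constructor
  · induction x using Quotient.inductionOn with
    | h x =>
      cases x with
      | atom a => exact fun _ => ⟨a, rfl⟩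
      | set ι f => exact fun h => h.elim
  · rintro ⟨a, rfl⟩
    trivial

theorem atom_injective : Function.Injective (atom : A → Univ A) := fun _ _ h =>
  Quotient.exact (s := PreUniv.setoid A) h

theorem not_mem_atom (x : Univ A) (a : A) : x ∉ atom a := by
  induction x using Quotient.inductionOn with
  | h x => exact id

/-- The elements of any object form a small family. -/
theorem exists_family (x : Univ A) :
    ∃ (ι : Type u) (f : ι → Univ A), ∀ y, y ∈ x ↔ ∃ i, y = f i := by
  induction x using Quotient.inductionOn with
  | h x =>
    cases x with
    | atom a => exact ⟨PEmpty, PEmpty.elim, fun y =>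
        ⟨fun h => (not_mem_atom y a h).elim, fun ⟨i, _⟩ => i.elim⟩⟩
    | set ι f =>
      refine ⟨ι, fun i => Quotient.mk _ (f i), fun y => ?_⟩
      induction y using Quotient.inductionOn with
      | h y => exact exists_congr fun i => (Quotient.eq (r := PreUniv.setoid A)).symm

/-- Extensionality: sets with the same elements are equal. -/
theorem ext {x y : Univ A} (hx : ¬ x.IsAtom) (hy : ¬ y.IsAtom) (h : ∀ z, z ∈ x ↔ z ∈ y) :
    x = y := by
  induction x using Quotient.inductionOn with
  | h x =>
  induction y using Quotient.inductionOn with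
  | h y =>
    cases x with
    | atom a => exact (hx trivial).elim
    | set ι f =>
    cases y with
    | atom a => exact (hy trivial).elim
    | set κ g =>
      refine Quotient.sound (s := PreUniv.setoid A) ⟨fun i => ?_, fun j => ?_⟩
      · exact (h (Quotient.mk _ (f i))).1 ⟨i, PreUniv.Equiv.refl _⟩
      · obtain ⟨i, hi⟩ := (h (Quotient.mk _ (g j))).2 ⟨j, PreUniv.Equiv.refl _⟩
        exact ⟨i, hi.symm⟩

theorem smul_atom (π : Equiv.Perm A) (a : A) : π • atom a = atom (π a) := rfl

theorem smul_mem_smul (π : Equiv.Perm A) {x y : Univ A} (h : y ∈ x) : π • y ∈ π • x := by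
  induction x using Quotient.inductionOn with
  | h x =>
  induction y using Quotient.inductionOn with
  | h y =>
    cases x with
    | atom a => exact h.elim
    | set ι f =>
      obtain ⟨i, hi⟩ := h
      exact ⟨i, PreUniv.act_equiv π hi⟩

theorem mem_smul {π : Equiv.Perm A} {x y : Univ A} : y ∈ π • x ↔ π⁻¹ • y ∈ x := by
  constructor
  · intro h
    simpa using smul_mem_smul π⁻¹ h
  · intro h
    simpa using smul_mem_smul π h

theorem isAtom_smul {π : Equiv.Perm A} {x : Univ A} : (π • x).IsAtom ↔ x.IsAtom := by
  induction x using Quotient.inductionOn with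
  | h x => cases x <;> exact Iff.rfl

theorem smul_ofFamily (π : Equiv.Perm A) {ι : Type u} (f : ι → Univ A) :
    π • ofFamily f = ofFamily fun i => π • f i := by
  refine ext (mt isAtom_smul.1 (not_isAtom_ofFamily f)) (not_isAtom_ofFamily _) fun z => ?_
  rw [mem_smul, mem_ofFamily, mem_ofFamily]
  exact exists_congr fun i => inv_smul_eq_iff

/-- The unordered pair `{x, y}`. -/
noncomputable def upair (x y : Univ A) : Univ A :=
  ofFamily fun b : ULift.{u} Bool => cond b.down x y

theorem mem_upair {x y z : Univ A} : z ∈ upair x y ↔ z = x ∨ z = y := by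
  simp [upair, mem_ofFamily, or_comm]

theorem not_isAtom_upair (x y : Univ A) : ¬ (upair x y).IsAtom := not_isAtom_ofFamily _

theorem eq_upair_iff {x y z : Univ A} :
    z = upair x y ↔ ¬ z.IsAtom ∧ ∀ w, w ∈ z ↔ w = x ∨ w = y := by
  constructor
  · rintro rfl
    exact ⟨not_isAtom_upair x y, fun w => mem_upair⟩
  · rintro ⟨hz, h⟩
    exact ext hz (not_isAtom_upair x y) fun w => (h w).trans mem_upair.symm

theorem smul_upair (π : Equiv.Perm A) (x y : Univ A) :
    π • upair x y = upair (π • x) (π • y) := by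
  rw [upair, smul_ofFamily, upair]
  congr 1
  funext ⟨b⟩
  cases b <;> rfl

theorem upair_comm (x y : Univ A) : upair x y = upair y x :=
  eq_upair_iff.2 ⟨not_isAtom_upair _ _, fun _ => mem_upair.trans or_comm⟩

theorem upair_eq_upair {x y x' y' : Univ A} (h : upair x y = upair x' y') :
    x = x' ∧ y = y' ∨ x = y' ∧ y = x' := by
  have h1 : x = x' ∨ x = y' := mem_upair.1 (h ▸ mem_upair.2 (Or.inl rfl))
  have h2 : y = x' ∨ y = y' := mem_upair.1 (h ▸ mem_upair.2 (Or.inr rfl))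
  have h3 : x' = x ∨ x' = y := mem_upair.1 (h ▸ mem_upair.2 (Or.inl rfl))
  have h4 : y' = x ∨ y' = y := mem_upair.1 (h ▸ mem_upair.2 (Or.inr rfl))
  grind

/-- The ordered pair `⟨x, y⟩ = {{x}, {x, y}}`. -/
noncomputable def opair (x y : Univ A) : Univ A := upair (upair x x) (upair x y)

theorem smul_opair (π : Equiv.Perm A) (x y : Univ A) :
    π • opair x y = opair (π • x) (π • y) := by
  simp only [opair, smul_upair]

theorem opair_inj {x y x' y' : Univ A} : opair x y = opair x' y' ↔ x = x' ∧ y = y' := by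
  refine ⟨fun h => ?_, by rintro ⟨rfl, rfl⟩; rfl⟩
  rcases upair_eq_upair h with ⟨h1, h2⟩ | ⟨h1, h2⟩ <;>
    have h1 := upair_eq_upair h1 <;> have h2 := upair_eq_upair h2 <;> grind

/-! ### The first stages of the cumulative hierarchy -/

theorem mem_cumul_zero {x : Univ A} : x ∈ cumul A 0 ↔ x.IsAtom := by
  rw [cumul, Ordinal.limitRecOn_zero]; rfl

theorem mem_cumul_succ {α : Ordinal.{u}} {x : Univ A} (hx : ¬ x.IsAtom)
    (h : ∀ y ∈ x, y ∈ cumul A α) : x ∈ cumul A (α + 1) := by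
  rw [cumul, Ordinal.limitRecOn_add_one]
  exact Or.inr ⟨hx, h⟩

theorem upair_mem_cumul_succ {α : Ordinal.{u}} {x y : Univ A} (hx : x ∈ cumul A α)
    (hy : y ∈ cumul A α) : upair x y ∈ cumul A (α + 1) := by
  refine mem_cumul_succ (not_isAtom_upair x y) fun z hz => ?_
  rcases mem_upair.1 hz with rfl | rfl <;> assumption

theorem opair_mem_cumul {α : Ordinal.{u}} {x y : Univ A} (hx : x ∈ cumul A α)
    (hy : y ∈ cumul A α) : opair x y ∈ cumul A (α + 1 + 1) :=
  upair_mem_cumul_succ (upair_mem_cumul_succ hx hx) (upair_mem_cumul_succ hx hy)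

end Univ

/-! ### Permutation models with finite supports -/

section Models

open Univ

variable {A : Type u} {G : Subgroup (Equiv.Perm A)}

/-- `E` supports `x`: every permutation in `G` that fixes `E` pointwise fixes `x`. -/
def Supports (G : Subgroup (Equiv.Perm A)) (E : Set A) (x : Univ A) : Prop :=
  ∀ π ∈ G, (∀ e ∈ E, π e = e) → π • x = x

theorem stabilizer_mem_finiteSupportFilter {x : Univ A} :
    MulAction.stabilizer G x ∈ finiteSupportFilter G ↔ ∃ E : Set A, E.Finite ∧ Supports G E x := by
  refine exists_congr fun E => and_congr_right fun _ => ⟨fun h π hπ hE => ?_, fun h π hπ => ?_⟩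
  · exact h (x := ⟨π, hπ⟩) (by rw [mem_fixingSubgroup_iff]; exact hE)
  · rw [mem_fixingSubgroup_iff] at hπ
    exact h π.1 π.2 hπ

/-- The permutation model over `G` given by finite supports. -/
abbrev finiteSupportModel (G : Subgroup (Equiv.Perm A)) : Set (Univ A) :=
  permutationModel G (finiteSupportFilter G)

theorem mem_finiteSupportModel {x : Univ A} :
    x ∈ finiteSupportModel G ↔
      (∃ E : Set A, E.Finite ∧ Supports G E x) ∧ ∀ y ∈ x, y ∈ finiteSupportModel G := by
  rw [← stabilizer_mem_finiteSupportFilter]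
  exact ⟨fun h => by cases h with | intro _ h1 h2 => exact ⟨h1, h2⟩, fun h => .intro x h.1 h.2⟩

theorem mem_finiteSupportModel_of_mem {x y : Univ A} (hx : x ∈ finiteSupportModel G)
    (hy : y ∈ x) : y ∈ finiteSupportModel G :=
  (mem_finiteSupportModel.1 hx).2 y hy

theorem atom_mem_finiteSupportModel (a : A) : atom a ∈ finiteSupportModel G := by
  refine mem_finiteSupportModel.2
    ⟨⟨{a}, Set.finite_singleton a, fun π _ h => ?_⟩, fun y hy => (not_mem_atom y a hy).elim⟩
  rw [smul_atom, h a rfl]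

/-- A family of objects of the model that the pointwise stabilizer of a finite set of atoms
permutes is a set of the model. -/
theorem ofFamily_mem_finiteSupportModel {ι : Type u} {f : ι → Univ A}
    (hf : ∀ i, f i ∈ finiteSupportModel G) {E : Set A} (hE : E.Finite)
    (h : ∀ π ∈ G, (∀ e ∈ E, π e = e) → ∀ i, ∃ j, π • f i = f j) :
    ofFamily f ∈ finiteSupportModel G := by
  refine mem_finiteSupportModel.2 ⟨⟨E, hE, fun π hπ hfix => ?_⟩, fun y hy => ?_⟩
  · refine ext (mt isAtom_smul.1 (not_isAtom_ofFamily f)) (not_isAtom_ofFamily f) fun z => ?_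
    rw [smul_ofFamily, mem_ofFamily, mem_ofFamily]
    constructor
    · rintro ⟨i, rfl⟩
      exact h π hπ hfix i
    · rintro ⟨i, rfl⟩
      obtain ⟨j, hj⟩ := h π⁻¹ (inv_mem hπ)
        (fun e he => by rw [Equiv.Perm.inv_eq_iff_eq, hfix e he]) i
      exact ⟨j, inv_smul_eq_iff.1 hj⟩
  · obtain ⟨i, rfl⟩ := mem_ofFamily.1 hy
    exact hf i

theorem upair_mem_finiteSupportModel {x y : Univ A} (hx : x ∈ finiteSupportModel G)
    (hy : y ∈ finiteSupportModel G) : upair x y ∈ finiteSupportModel G := by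
  obtain ⟨E, hE, hxE⟩ := (mem_finiteSupportModel.1 hx).1
  obtain ⟨F, hF, hyF⟩ := (mem_finiteSupportModel.1 hy).1
  refine ofFamily_mem_finiteSupportModel ?_ (hE.union hF) fun π hπ h i => ⟨i, ?_⟩
  · rintro ⟨_ | _⟩ <;> assumption
  · have h1 := hxE π hπ fun e he => h e (Or.inl he)
    have h2 := hyF π hπ fun e he => h e (Or.inr he)
    obtain ⟨_ | _⟩ := i <;> assumption

theorem opair_mem_finiteSupportModel {x y : Univ A} (hx : x ∈ finiteSupportModel G)
    (hy : y ∈ finiteSupportModel G) : opair x y ∈ finiteSupportModel G :=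
  upair_mem_finiteSupportModel (upair_mem_finiteSupportModel hx hx)
    (upair_mem_finiteSupportModel hx hy)

/-- Comprehension in the model: a relation between two sets of the model that is invariant under
the pointwise stabilizer of a finite set of atoms has its graph in the model. -/
theorem exists_graph {x y : Univ A} (hx : x ∈ finiteSupportModel G)
    (hy : y ∈ finiteSupportModel G) {E : Set A} (hE : E.Finite) {P : Univ A → Univ A → Prop}
    (hP : ∀ π ∈ G, (∀ e ∈ E, π e = e) → ∀ s t, P s t → P (π • s) (π • t)) :
    ∃ h ∈ finiteSupportModel G, ¬ h.IsAtom ∧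
      ∀ z, z ∈ h ↔ ∃ s ∈ x, ∃ t ∈ y, P s t ∧ z = opair s t := by
  obtain ⟨Ex, hEx, hxE⟩ := (mem_finiteSupportModel.1 hx).1
  obtain ⟨Ey, hEy, hyE⟩ := (mem_finiteSupportModel.1 hy).1
  obtain ⟨ι, f, hf⟩ := exists_family x
  obtain ⟨κ, g, hg⟩ := exists_family y
  refine ⟨ofFamily fun p : {p : ι × κ // P (f p.1) (g p.2)} => opair (f p.1.1) (g p.1.2),
    ofFamily_mem_finiteSupportModel ?_ (hE.union (hEx.union hEy)) ?_, not_isAtom_ofFamily _,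
    fun z => ?_⟩
  · rintro ⟨⟨i, j⟩, h⟩
    exact opair_mem_finiteSupportModel (mem_finiteSupportModel_of_mem hx ((hf _).2 ⟨i, rfl⟩))
      (mem_finiteSupportModel_of_mem hy ((hg _).2 ⟨j, rfl⟩))
  · rintro π hπ hfix ⟨⟨i, j⟩, h⟩
    have h1 : π • f i ∈ π • x := smul_mem_smul π ((hf _).2 ⟨i, rfl⟩)
    have h2 : π • g j ∈ π • y := smul_mem_smul π ((hg _).2 ⟨j, rfl⟩)
    rw [hxE π hπ fun e he => hfix e (Or.inr (Or.inl he)), hf] at h1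
    rw [hyE π hπ fun e he => hfix e (Or.inr (Or.inr he)), hg] at h2
    obtain ⟨i', hi'⟩ := h1
    obtain ⟨j', hj'⟩ := h2
    have h3 := hP π hπ (fun e he => hfix e (Or.inl he)) _ _ h
    refine ⟨⟨(i', j'), ?_⟩, ?_⟩
    · rwa [hi', hj'] at h3
    · exact (smul_opair π _ _).trans (congrArg₂ opair hi' hj')
  · rw [mem_ofFamily]
    constructor
    · rintro ⟨⟨⟨i, j⟩, h⟩, rfl⟩
      exact ⟨f i, (hf _).2 ⟨i, rfl⟩, g j, (hg _).2 ⟨j, rfl⟩, h, rfl⟩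
    · rintro ⟨s, hs, t, ht, h, rfl⟩
      obtain ⟨i, rfl⟩ := (hf _).1 hs
      obtain ⟨j, rfl⟩ := (hg _).1 ht
      exact ⟨⟨(i, j), h⟩, rfl⟩

/-! ### Absoluteness of the basic notions -/

theorem isUnorderedPair_iff {z x y : finiteSupportModel G} :
    IsUnorderedPair z x y ↔ z.1 = upair x.1 y.1 := by
  rw [eq_upair_iff]
  refine and_congr_right fun _ => ⟨fun h w => ⟨fun hw => ?_, ?_⟩, fun h w => ?_⟩
  · have hw' := mem_finiteSupportModel_of_mem z.2 hw
    simpa [Subtype.ext_iff] using (h ⟨w, hw'⟩).1 hw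
  · rintro (rfl | rfl)
    · exact (h x).2 (Or.inl rfl)
    · exact (h y).2 (Or.inr rfl)
  · rw [Subtype.ext_iff, Subtype.ext_iff]
    exact h w.1

theorem isOrderedPair_iff {z x y : finiteSupportModel G} :
    IsOrderedPair z x y ↔ z.1 = opair x.1 y.1 := by
  simp only [IsOrderedPair, isUnorderedPair_iff]
  constructor
  · rintro ⟨s, t, hs, ht, hz⟩
    rw [hz, hs, ht, opair]
  · intro h
    exact ⟨⟨_, upair_mem_finiteSupportModel x.2 x.2⟩, ⟨_, upair_mem_finiteSupportModel x.2 y.2⟩,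
      rfl, rfl, h⟩

theorem rel_iff {f x y : finiteSupportModel G} : Rel f x y ↔ opair x.1 y.1 ∈ f.1 := by
  simp only [Rel, isOrderedPair_iff]
  constructor
  · rintro ⟨w, hw, h⟩
    exact h ▸ hw
  · intro h
    exact ⟨⟨_, opair_mem_finiteSupportModel x.2 y.2⟩, h, rfl⟩

theorem isInjection_iff {f x y : finiteSupportModel G} :
    IsInjection f x y ↔
      (¬ f.1.IsAtom ∧ (∀ z ∈ f.1, ∃ s ∈ x.1, ∃ t ∈ y.1, z = opair s t) ∧
        (∀ s ∈ x.1, ∃ t, opair s t ∈ f.1) ∧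
        ∀ s t t', opair s t ∈ f.1 → opair s t' ∈ f.1 → t = t') ∧
      ∀ s s' t, opair s t ∈ f.1 → opair s' t ∈ f.1 → s = s' := by
  have mem_fst : ∀ {s t : Univ A}, opair s t ∈ f.1 → s ∈ finiteSupportModel G := fun {s t} h =>
    mem_finiteSupportModel_of_mem (mem_finiteSupportModel_of_mem (mem_finiteSupportModel_of_mem
      f.2 h) (mem_upair.2 (Or.inl rfl))) (mem_upair.2 (Or.inl rfl))
  have mem_snd : ∀ {s t : Univ A}, opair s t ∈ f.1 → t ∈ finiteSupportModel G := fun {s t} h =>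
    mem_finiteSupportModel_of_mem (mem_finiteSupportModel_of_mem (mem_finiteSupportModel_of_mem
      f.2 h) (mem_upair.2 (Or.inr rfl))) (mem_upair.2 (Or.inr rfl))
  simp only [IsInjection, IsFunction, rel_iff, isOrderedPair_iff]
  constructor
  · rintro ⟨⟨hf, hdom, hfun⟩, hinj⟩
    have hdom' : ∀ z ∈ f.1, ∃ s ∈ x.1, ∃ t ∈ y.1, z = opair s t := fun z hz => by
      obtain ⟨u, hu, v, hv, h⟩ := hdom ⟨z, mem_finiteSupportModel_of_mem f.2 hz⟩ hz
      exact ⟨u.1, hu, v.1, hv, h⟩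
    refine ⟨⟨hf, hdom', fun s hs => ?_, fun s t t' h h' => ?_⟩, fun s s' t h h' => ?_⟩
    · obtain ⟨v, hv, -⟩ := hfun ⟨s, mem_finiteSupportModel_of_mem x.2 hs⟩ hs
      exact ⟨v.1, hv⟩
    · obtain ⟨s₁, hs₁, t₁, -, e⟩ := hdom' _ h
      obtain ⟨rfl, -⟩ := opair_inj.1 e
      exact congrArg Subtype.val ((hfun ⟨s, mem_fst h⟩ hs₁).unique
        (y₁ := ⟨t, mem_snd h⟩) (y₂ := ⟨t', mem_snd h'⟩) h h')
    · exact congrArg Subtype.val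
        (hinj ⟨s, mem_fst h⟩ ⟨s', mem_fst h'⟩ ⟨t, mem_snd h⟩ h h')
  · rintro ⟨⟨hf, hdom, htot, hfun⟩, hinj⟩
    refine ⟨⟨hf, fun w hw => ?_, fun u hu => ?_⟩, fun u u' v h h' => Subtype.ext (hinj _ _ _ h h')⟩
    · obtain ⟨s, hs, t, ht, h⟩ := hdom w.1 hw
      exact ⟨⟨s, mem_finiteSupportModel_of_mem x.2 hs⟩, hs,
        ⟨t, mem_finiteSupportModel_of_mem y.2 ht⟩, ht, h⟩
    · obtain ⟨t, ht⟩ := htot u.1 hu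
      exact ⟨⟨t, mem_snd ht⟩, ht, fun v hv => Subtype.ext (hfun _ _ _ hv ht)⟩

theorem IsBijection.exists_fst {f x y : finiteSupportModel G} (h : IsBijection f x y)
    {t : Univ A} (ht : t ∈ y.1) : ∃ s ∈ x.1, opair s t ∈ f.1 := by
  obtain ⟨u, hu, h⟩ := h.2 ⟨t, mem_finiteSupportModel_of_mem y.2 ht⟩ ht
  exact ⟨u.1, hu, rel_iff.1 h⟩

/-- The graph of an invariant injective function is an injection in the model. -/
theorem exists_isInjection {x y : finiteSupportModel G} {E : Set A} (hE : E.Finite)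
    {P : Univ A → Univ A → Prop}
    (hP : ∀ π ∈ G, (∀ e ∈ E, π e = e) → ∀ s t, P s t → P (π • s) (π • t))
    (htot : ∀ s ∈ x.1, ∃ t ∈ y.1, P s t)
    (hfun : ∀ s ∈ x.1, ∀ t ∈ y.1, ∀ t' ∈ y.1, P s t → P s t' → t = t')
    (hinj : ∀ s ∈ x.1, ∀ s' ∈ x.1, ∀ t ∈ y.1, P s t → P s' t → s = s') :
    ∃ f : finiteSupportModel G, IsInjection f x y ∧
      ∀ s ∈ x.1, ∀ t ∈ y.1, P s t → opair s t ∈ f.1 := by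
  obtain ⟨f, hf, hset, hmem⟩ := exists_graph x.2 y.2 hE hP
  have key : ∀ {s t}, opair s t ∈ f ↔ s ∈ x.1 ∧ t ∈ y.1 ∧ P s t := fun {s t} => by
    rw [hmem]
    constructor
    · rintro ⟨s', hs, t', ht, h, e⟩
      obtain ⟨rfl, rfl⟩ := opair_inj.1 e
      exact ⟨hs, ht, h⟩
    · rintro ⟨hs, ht, h⟩
      exact ⟨s, hs, t, ht, h, rfl⟩
  refine ⟨⟨f, hf⟩, isInjection_iff.2 ⟨⟨hset, fun z hz => ?_, fun s hs => ?_,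
    fun s t t' h h' => ?_⟩, fun s s' t h h' => ?_⟩, fun s hs t ht h => key.2 ⟨hs, ht, h⟩⟩
  · obtain ⟨s, hs, t, ht, -, e⟩ := (hmem z).1 hz
    exact ⟨s, hs, t, ht, e⟩
  · obtain ⟨t, ht, h⟩ := htot s hs
    exact ⟨t, key.2 ⟨hs, ht, h⟩⟩
  · have h := key.1 h
    have h' := key.1 h'
    exact hfun s h.1 t h.2.1 t' h'.2.1 h.2.2 h'.2.2
  · have h := key.1 h
    have h' := key.1 h'
    exact hinj s h.1 s' h'.1 t h.2.1 h.2.2 h'.2.2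

theorem mem_equinumerous_self {x : finiteSupportModel G} (hx : IsSet x) : x ∈ equinumerous x := by
  obtain ⟨f, hf, hmem⟩ := exists_isInjection (x := x) (y := x) Set.finite_empty
    (P := fun s t => s = t) (fun _ _ _ _ _ h => congrArg _ h) (fun s hs => ⟨s, hs, rfl⟩)
    (fun _ _ _ _ _ _ h h' => h.symm.trans h') (fun _ _ _ _ _ _ h h' => h.trans h'.symm)
  exact ⟨hx, f, hf, fun v hv => ⟨v, hv, rel_iff.2 (hmem _ hv _ hv rfl)⟩⟩

theorem cardinality_nonempty {x : finiteSupportModel G} (hx : IsSet x) {α : Ordinal.{u}}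
    (hα : x.1 ∈ cumul A α) : (cardinality x).Nonempty := by
  have hne : {β | ∃ y ∈ equinumerous x, y.1 ∈ cumul A β}.Nonempty :=
    ⟨α, x, mem_equinumerous_self hx, hα⟩
  obtain ⟨y, hy, hyα⟩ := csInf_mem hne
  exact ⟨y, hy, _, ⟨csInf_mem hne, fun _ h => csInf_le' h⟩, hyα⟩

end Models

/-! ### Coding pairs of atoms by pairs of atoms -/

section Atoms

open PreAtom

variable {A₀ : Type u}

/-- Permutations in the group map `(n+1, ⟨x, y⟩, ε)` to `(n+1, ⟨π x, π y⟩, δ + ε)`, with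
the same `δ` for both values of `ε`. -/
theorem exists_apply_node {π : Equiv.Perm (Atom A₀)} (hπ : π ∈ atomGroup A₀) {n : ℕ}
    (x y : level A₀ n) : ∃ x' y' : level A₀ n, ∃ δ : ZMod 2,
      π (level.toAtom x) = level.toAtom x' ∧ π (level.toAtom y) = level.toAtom y' ∧
      ∀ ε, π (level.toAtom (level.node x y ε)) = level.toAtom (level.node x' y' (δ + ε)) := by
  obtain ⟨h, ⟨g, -, δ, h1, h2⟩, e⟩ := hπ (n + 1)
  refine ⟨g x, g y, δ, (e (level.lift x)).trans ?_, (e (level.lift y)).trans ?_, fun ε => ?_⟩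
  · rw [h1]; rfl
  · rw [h1]; rfl
  · rw [e, h2]

theorem apply_mem_level {π : Equiv.Perm (Atom A₀)} (hπ : π ∈ atomGroup A₀) {n : ℕ}
    {x : Atom A₀} (hx : x.1 ∈ level A₀ n) : (π x).1 ∈ level A₀ n := by
  obtain ⟨g, -, e⟩ := hπ n
  exact e ⟨x.1, hx⟩ ▸ (g ⟨x.1, hx⟩).2

theorem apply_mem_level_iff {π : Equiv.Perm (Atom A₀)} (hπ : π ∈ atomGroup A₀) {n : ℕ}
    {x : Atom A₀} : (π x).1 ∈ level A₀ n ↔ x.1 ∈ level A₀ n :=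
  ⟨fun h => by simpa using apply_mem_level (inv_mem hπ) h, apply_mem_level hπ⟩

theorem level_mono : Monotone (level A₀) := monotone_nat_of_le_succ fun _ _ => Or.inl

theorem exists_mem_level (x y : Atom A₀) : ∃ n, x.1 ∈ level A₀ n ∧ y.1 ∈ level A₀ n := by
  obtain ⟨m, hm⟩ := Set.mem_iUnion.1 x.2
  obtain ⟨n, hn⟩ := Set.mem_iUnion.1 y.2
  exact ⟨max m n, level_mono (le_max_left _ _) hm, level_mono (le_max_right _ _) hn⟩

/-- The least `n` with `x, y ∈ A_n`. -/
noncomputable def pairLevel (x y : Atom A₀) : ℕ :=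
  sInf {n | x.1 ∈ level A₀ n ∧ y.1 ∈ level A₀ n}

theorem mem_level_pairLevel (x y : Atom A₀) :
    x.1 ∈ level A₀ (pairLevel x y) ∧ y.1 ∈ level A₀ (pairLevel x y) :=
  Nat.sInf_mem (exists_mem_level x y)

/-- The atom `(n+1, ⟨x, y⟩, ε)`, where `n` is least with `x, y ∈ A_n`. -/
noncomputable def pairNode (x y : Atom A₀) (ε : ZMod 2) : Atom A₀ :=
  level.toAtom (level.node ⟨x.1, (mem_level_pairLevel x y).1⟩
    ⟨y.1, (mem_level_pairLevel x y).2⟩ ε)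

theorem pairNode_inj {x y x' y' : Atom A₀} {ε ε' : ZMod 2} :
    pairNode x y ε = pairNode x' y' ε' ↔ x = x' ∧ y = y' ∧ ε = ε' := by
  constructor
  · intro h
    have h : PreAtom.node (pairLevel x y + 1) x.1 y.1 ε =
      PreAtom.node (pairLevel x' y' + 1) x'.1 y'.1 ε' := congrArg Subtype.val h
    injection h with _ h1 h2 h3
    exact ⟨Subtype.ext h1, Subtype.ext h2, h3⟩
  · rintro ⟨rfl, rfl, rfl⟩
    rfl

theorem pairLevel_apply {π : Equiv.Perm (Atom A₀)} (hπ : π ∈ atomGroup A₀) (x y : Atom A₀) :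
    pairLevel (π x) (π y) = pairLevel x y := by
  simp only [pairLevel, apply_mem_level_iff hπ]

theorem exists_apply_pairNode {π : Equiv.Perm (Atom A₀)} (hπ : π ∈ atomGroup A₀)
    (x y : Atom A₀) : ∃ δ, ∀ ε, π (pairNode x y ε) = pairNode (π x) (π y) (δ + ε) := by
  have hxy := mem_level_pairLevel x y
  obtain ⟨x', y', δ, hx, hy, h⟩ := exists_apply_node hπ ⟨x.1, hxy.1⟩ ⟨y.1, hxy.2⟩
  refine ⟨δ, fun ε => (h ε).trans (Subtype.ext ?_)⟩
  change PreAtom.node (pairLevel x y + 1) x'.1 y'.1 (δ + ε) =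
    PreAtom.node (pairLevel (π x) (π y) + 1) (π x).1 (π y).1 (δ + ε)
  rw [pairLevel_apply hπ]
  congr 1
  · exact (congrArg Subtype.val hx).symm
  · exact (congrArg Subtype.val hy).symm

/-- The set `{(n+1, ⟨x, y⟩, 0), (n+1, ⟨x, y⟩, 1)}`, where `n` is least with `x, y ∈ A_n`. -/
noncomputable def pairCode (x y : Atom A₀) : Univ (Atom A₀) :=
  Univ.upair (Univ.atom (pairNode x y 0)) (Univ.atom (pairNode x y 1))

theorem pairCode_inj {x y x' y' : Atom A₀} :
    pairCode x y = pairCode x' y' ↔ x = x' ∧ y = y' := by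
  refine ⟨fun h => ?_, by rintro ⟨rfl, rfl⟩; rfl⟩
  rcases Univ.upair_eq_upair h with ⟨h, -⟩ | ⟨h, -⟩ <;>
    exact ⟨(pairNode_inj.1 (Univ.atom_injective h)).1,
      (pairNode_inj.1 (Univ.atom_injective h)).2.1⟩

/-- The code of a pair is a set, so it does not matter if `π` exchanges its two elements. -/
theorem smul_pairCode {π : Equiv.Perm (Atom A₀)} (hπ : π ∈ atomGroup A₀) (x y : Atom A₀) :
    π • pairCode x y = pairCode (π x) (π y) := by
  obtain ⟨δ, h⟩ := exists_apply_pairNode hπ x y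
  rw [pairCode, pairCode, Univ.smul_upair, Univ.smul_atom, Univ.smul_atom, h, h]
  have h2 : ∀ δ : ZMod 2, δ = 0 ∨ δ = 1 := by decide
  rcases h2 δ with rfl | rfl
  · rw [zero_add, zero_add]
  · rw [add_zero, CharTwo.add_self_eq_zero, Univ.upair_comm]

/-! ### Permutations induced by permutations of `A₀` -/

/-- The action of a permutation of `A₀` on formal tuples, leaving the labels unchanged. -/
def mapBase (σ : Equiv.Perm A₀) : PreAtom A₀ → PreAtom A₀
  | base a => base (σ a)
  | node n x y ε => node n (mapBase σ x) (mapBase σ y) ε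

/-- The elements of `A₀` that occur in a formal tuple. -/
def leaves : PreAtom A₀ → Set A₀
  | base a => {a}
  | node _ x y _ => leaves x ∪ leaves y

theorem finite_leaves (t : PreAtom A₀) : (leaves t).Finite := by
  induction t with
  | base a => exact Set.finite_singleton a
  | node n x y ε hx hy => exact hx.union hy

theorem mapBase_eq_self_iff {σ : Equiv.Perm A₀} {t : PreAtom A₀} :
    mapBase σ t = t ↔ ∀ a ∈ leaves t, σ a = a := by
  induction t with
  | base a => simp [mapBase, leaves]
  | node n x y ε hx hy => simp [mapBase, leaves, hx, hy, or_imp, forall_and]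

theorem mapBase_mapBase (σ τ : Equiv.Perm A₀) (t : PreAtom A₀) :
    mapBase σ (mapBase τ t) = mapBase (σ * τ) t := by
  induction t with
  | base a => rfl
  | node n x y ε hx hy => simp [mapBase, hx, hy]

theorem mapBase_one (t : PreAtom A₀) : mapBase 1 t = t :=
  mapBase_eq_self_iff.2 fun _ _ => rfl

theorem mapBase_mem_level (σ : Equiv.Perm A₀) {n : ℕ} {t : PreAtom A₀} (ht : t ∈ level A₀ n) :
    mapBase σ t ∈ level A₀ n := by
  induction n generalizing t with
  | zero =>
    obtain ⟨a, rfl⟩ := ht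
    exact ⟨σ a, rfl⟩
  | succ n ih =>
    rcases ht with ht | ⟨x, hx, y, hy, ε, rfl⟩
    · exact Or.inl (ih ht)
    · exact Or.inr ⟨_, ih hx, _, ih hy, ε, rfl⟩

/-- The permutation induced by `σ` on a set of formal tuples that is closed under the action of
all permutations of `A₀`. -/
def mapBasePerm (σ : Equiv.Perm A₀) (s : Set (PreAtom A₀))
    (hs : ∀ (τ : Equiv.Perm A₀), ∀ t ∈ s, mapBase τ t ∈ s) : Equiv.Perm s where
  toFun t := ⟨mapBase σ t.1, hs σ t.1 t.2⟩
  invFun t := ⟨mapBase σ⁻¹ t.1, hs σ⁻¹ t.1 t.2⟩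
  left_inv t := Subtype.ext (by simp [mapBase_mapBase, mapBase_one])
  right_inv t := Subtype.ext (by simp [mapBase_mapBase, mapBase_one])

theorem mapBasePerm_mem_levelGroup (σ : Equiv.Perm A₀) (n : ℕ) :
    mapBasePerm σ (level A₀ n) (fun τ _ => mapBase_mem_level τ) ∈ levelGroup A₀ n := by
  induction n with
  | zero => exact Subgroup.mem_top _
  | succ n ih =>
    refine ⟨_, ih, 0, fun x => rfl, fun x y ε => ?_⟩
    rw [zero_add]
    rfl

/-- The permutation of the atoms induced by a permutation of `A₀`. -/
def atomPerm (σ : Equiv.Perm A₀) : Equiv.Perm (Atom A₀) :=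
  mapBasePerm σ (⋃ n, level A₀ n) fun τ _ ht =>
    Set.mem_iUnion.2 ((Set.mem_iUnion.1 ht).imp fun _ => mapBase_mem_level τ)

theorem atomPerm_mem (σ : Equiv.Perm A₀) : atomPerm σ ∈ atomGroup A₀ := fun n =>
  ⟨_, mapBasePerm_mem_levelGroup σ n, fun _ => rfl⟩

theorem atomPerm_eq_self_iff {σ : Equiv.Perm A₀} {x : Atom A₀} :
    atomPerm σ x = x ↔ ∀ a ∈ leaves x.1, σ a = a :=
  Subtype.ext_iff.trans mapBase_eq_self_iff

/-- An element of `A₀`, as an atom. -/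
def baseAtom (a : A₀) : Atom A₀ := level.toAtom (n := 0) ⟨base a, a, rfl⟩

theorem baseAtom_injective : Function.Injective (baseAtom : A₀ → Atom A₀) := fun a b h => by
  have := congrArg Subtype.val h
  injection this

theorem atomPerm_baseAtom (σ : Equiv.Perm A₀) (a : A₀) :
    atomPerm σ (baseAtom a) = baseAtom (σ a) := rfl

/-! ### Comparing the two cardinals -/

open Univ

/-- The injection `⟨a, b⟩ ↦ {(n+1, ⟨a, b⟩, 0), (n+1, ⟨a, b⟩, 1)}`, transported to arbitrary
representatives of the two cardinals. -/
theorem cardLE_of_forall_mem {aa pa : pairModel A₀}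
    (haa : ∀ z, z ∈ aa.1 ↔ ∃ a b, z = opair (atom a) (atom b))
    (hpa : ∀ z, z ∈ pa.1 ↔ ∃ a b, a ≠ b ∧ z = upair (atom a) (atom b)) :
    CardLE (cardinality aa) (cardinality pa) := by
  rintro x ⟨⟨-, f, hf⟩, -⟩ y ⟨⟨-, g, hg⟩, -⟩
  obtain ⟨⟨-, hfdom, hftot, hffun⟩, hfinj⟩ := isInjection_iff.1 hf.1
  obtain ⟨⟨-, -, -, hgfun⟩, hginj⟩ := isInjection_iff.1 hg.1
  obtain ⟨E, hE, hfE⟩ := (mem_finiteSupportModel.1 f.2).1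
  obtain ⟨F, hF, hgF⟩ := (mem_finiteSupportModel.1 g.2).1
  refine (exists_isInjection (x := x) (y := y) (hE.union hF)
    (P := fun s t => ∃ a b, opair s (opair (atom a) (atom b)) ∈ f.1 ∧
      opair t (pairCode a b) ∈ g.1) ?_ ?_ ?_ ?_).imp fun _ => And.left
  · rintro π hπ hfix s t ⟨a, b, h1, h2⟩
    refine ⟨π a, π b, ?_, ?_⟩
    · have := smul_mem_smul π h1
      rwa [hfE π hπ fun e he => hfix e (Or.inl he), smul_opair, smul_opair] at this
    · have := smul_mem_smul π h2
      rwa [hgF π hπ fun e he => hfix e (Or.inr he), smul_opair, smul_pairCode hπ] at this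
  · intro s hs
    obtain ⟨w, hw⟩ := hftot s hs
    obtain ⟨s', -, w', hw', e⟩ := hfdom _ hw
    obtain ⟨a, b, rfl⟩ := (haa w').1 hw'
    obtain ⟨rfl, rfl⟩ := opair_inj.1 e
    obtain ⟨t, ht, h⟩ := hg.exists_fst (t := pairCode a b)
      ((hpa _).2 ⟨_, _, fun h => zero_ne_one (pairNode_inj.1 h).2.2, rfl⟩)
    exact ⟨t, ht, a, b, hw, h⟩
  · rintro s - t - t' - ⟨a, b, h1, h2⟩ ⟨a', b', h1', h2'⟩
    obtain ⟨ha, hb⟩ := opair_inj.1 (hffun _ _ _ h1 h1')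
    obtain rfl := atom_injective ha
    obtain rfl := atom_injective hb
    exact hginj _ _ _ h2 h2'
  · rintro s - s' - t - ⟨a, b, h1, h2⟩ ⟨a', b', h1', h2'⟩
    obtain ⟨rfl, rfl⟩ := pairCode_inj.1 (hgfun _ _ _ h2 h2')
    exact hfinj _ _ _ h1 h1'

/-- No set of the model is equinumerous to both `A × A` and `[A]²`: in such a correspondence, let
`⟨p, q⟩` be the pair that corresponds to `{u, v}`, for `u, v ∈ A₀` outside the support. Exchanging
`u` and `v` fixes `{u, v}` and hence `p` and `q`, so `u` occurs neither in `p` nor in `q`.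
Exchanging `u` with a new `w` then fixes `⟨p, q⟩`, but moves `{u, v}`. -/
theorem equinumerous_disjoint [Infinite A₀] {aa pa : pairModel A₀}
    (haa : ∀ z, z ∈ aa.1 ↔ ∃ a b, z = opair (atom a) (atom b))
    (hpa : ∀ z, z ∈ pa.1 ↔ ∃ a b, a ≠ b ∧ z = upair (atom a) (atom b)) :
    Disjoint (equinumerous aa) (equinumerous pa) := by
  classical
  rw [Set.disjoint_left]
  rintro x ⟨-, f, hf⟩ ⟨-, g, hg⟩
  obtain ⟨⟨-, hfdom, hftot, hffun⟩, hfinj⟩ := isInjection_iff.1 hf.1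
  obtain ⟨⟨-, -, -, hgfun⟩, hginj⟩ := isInjection_iff.1 hg.1
  obtain ⟨E, hE, hfE⟩ := (mem_finiteSupportModel.1 f.2).1
  obtain ⟨F, hF, hgF⟩ := (mem_finiteSupportModel.1 g.2).1
  let S : Set A₀ := ⋃ e ∈ E ∪ F, leaves e.1
  have hS : S.Finite := (hE.union hF).biUnion fun e _ => finite_leaves e.1
  have hfS : ∀ σ : Equiv.Perm A₀, (∀ a ∈ S, σ a = a) → ∀ {s t}, opair s t ∈ f.1 →
      opair (atomPerm σ • s) (atomPerm σ • t) ∈ f.1 := fun σ hσ s t h => by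
    have := smul_mem_smul (atomPerm σ) h
    rwa [hfE _ (atomPerm_mem σ) fun e he => atomPerm_eq_self_iff.2 fun a ha =>
      hσ a (Set.mem_biUnion (Or.inl he) ha), smul_opair] at this
  have hgS : ∀ σ : Equiv.Perm A₀, (∀ a ∈ S, σ a = a) → ∀ {s t}, opair s t ∈ g.1 →
      opair (atomPerm σ • s) (atomPerm σ • t) ∈ g.1 := fun σ hσ s t h => by
    have := smul_mem_smul (atomPerm σ) h
    rwa [hgF _ (atomPerm_mem σ) fun e he => atomPerm_eq_self_iff.2 fun a ha =>
      hσ a (Set.mem_biUnion (Or.inr he) ha), smul_opair] at this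
  have hswap : ∀ {T : Set A₀} {u v : A₀}, u ∉ T → v ∉ T → ∀ a ∈ T, Equiv.swap u v a = a :=
    fun hu hv a ha => Equiv.swap_apply_of_ne_of_ne (fun h => hu (h ▸ ha)) (fun h => hv (h ▸ ha))
  obtain ⟨u, hu⟩ := hS.exists_notMem
  obtain ⟨v, hv⟩ := (hS.insert u).exists_notMem
  have huv : v ≠ u := fun h => hv (Or.inl h)
  have hvS : v ∉ S := fun h => hv (Or.inr h)
  obtain ⟨z, hz, hzg⟩ := hg.exists_fst (t := upair (atom (baseAtom u)) (atom (baseAtom v)))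
    ((hpa _).2 ⟨_, _, fun h => huv (baseAtom_injective h).symm, rfl⟩)
  obtain ⟨w, hzf⟩ := hftot z hz
  obtain ⟨_, -, _, hw, e⟩ := hfdom _ hzf
  obtain ⟨p, q, rfl⟩ := (haa _).1 hw
  obtain ⟨rfl, rfl⟩ := opair_inj.1 e
  have hpq : atomPerm (Equiv.swap u v) p = p ∧ atomPerm (Equiv.swap u v) q = q := by
    have h1 := hgS _ (hswap hu hvS) hzg
    rw [smul_upair, smul_atom, smul_atom, atomPerm_baseAtom, atomPerm_baseAtom,
      Equiv.swap_apply_left, Equiv.swap_apply_right, upair_comm] at h1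
    have h2 := hfS _ (hswap hu hvS) hzf
    rw [hginj _ _ _ h1 hzg, smul_opair, smul_atom, smul_atom] at h2
    have h3 := opair_inj.1 (hffun _ _ _ h2 hzf)
    exact ⟨atom_injective h3.1, atom_injective h3.2⟩
  have hup : u ∉ leaves p.1 := fun h => huv
    (by simpa using atomPerm_eq_self_iff.1 hpq.1 u h)
  have huq : u ∉ leaves q.1 := fun h => huv
    (by simpa using atomPerm_eq_self_iff.1 hpq.2 u h)
  obtain ⟨w, hw'⟩ := ((((hS.union (finite_leaves p.1)).union (finite_leaves q.1)).insert
    u).insert v).exists_notMem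
  simp only [Set.mem_insert_iff, Set.mem_union, not_or] at hw'
  obtain ⟨hwv, hwu, ⟨hwS, hwp⟩, hwq⟩ := hw'
  have h1 := hfS _ (hswap hu hwS) hzf
  rw [smul_opair, smul_atom, smul_atom, atomPerm_eq_self_iff.2 (hswap hup hwp),
    atomPerm_eq_self_iff.2 (hswap huq hwq)] at h1
  have h2 := hgS _ (hswap hu hwS) hzg
  rw [hfinj _ _ _ h1 hzf, smul_upair, smul_atom, smul_atom, atomPerm_baseAtom, atomPerm_baseAtom,
    Equiv.swap_apply_left, Equiv.swap_apply_of_ne_of_ne huv (Ne.symm hwv)] at h2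
  rcases upair_eq_upair (hgfun _ _ _ h2 hzg) with ⟨h, -⟩ | ⟨h, -⟩
  · exact hwu (baseAtom_injective (atom_injective h))
  · exact hwv (baseAtom_injective (atom_injective h))

end Atoms

end PermutationModel

open PermutationModel Univ in
theorem mainTheorem2 (A₀ : Type u) [Countable A₀] [Infinite A₀] :
    ∃ a aa pa : PermutationModel.pairModel A₀,
      PermutationModel.IsSetOfAtoms a ∧ PermutationModel.IsProduct aa a a ∧
      PermutationModel.IsSetOfPairs pa a ∧
      PermutationModel.CardLT (PermutationModel.cardinality aa)
        (PermutationModel.cardinality pa) := by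
  have ha : ofFamily (atom : Atom A₀ → _) ∈ pairModel A₀ :=
    ofFamily_mem_finiteSupportModel atom_mem_finiteSupportModel Set.finite_empty
      fun π _ _ i => ⟨π i, rfl⟩
  obtain ⟨aa, haa, haaset, hmem⟩ := exists_graph (P := fun _ _ => True) ha ha Set.finite_empty
    fun _ _ _ _ _ _ => trivial
  have haa' : ∀ z, z ∈ aa ↔ ∃ a b, z = opair (atom a) (atom b) := fun z => by
    rw [hmem]
    simp only [mem_ofFamily]
    constructor
    · rintro ⟨_, ⟨a, rfl⟩, _, ⟨b, rfl⟩, -, h⟩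
      exact ⟨a, b, h⟩
    · rintro ⟨a, b, h⟩
      exact ⟨_, ⟨a, rfl⟩, _, ⟨b, rfl⟩, trivial, h⟩
  have hpa : ofFamily (fun p : {p : Atom A₀ × Atom A₀ // p.1 ≠ p.2} =>
      upair (atom p.1.1) (atom p.1.2)) ∈ pairModel A₀ :=
    ofFamily_mem_finiteSupportModel (fun p => upair_mem_finiteSupportModel
      (atom_mem_finiteSupportModel _) (atom_mem_finiteSupportModel _)) Set.finite_empty
      fun π _ _ p => ⟨⟨(π p.1.1, π p.1.2), π.injective.ne p.2⟩, smul_upair _ _ _⟩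
  have hpa' : ∀ z, z ∈ ofFamily (fun p : {p : Atom A₀ × Atom A₀ // p.1 ≠ p.2} =>
      upair (atom p.1.1) (atom p.1.2)) ↔ ∃ a b, a ≠ b ∧ z = upair (atom a) (atom b) := fun z => by
    simp [mem_ofFamily]
  have hatom : ∀ a : Atom A₀, atom a ∈ pairModel A₀ := atom_mem_finiteSupportModel
  refine ⟨⟨_, ha⟩, ⟨aa, haa⟩, ⟨_, hpa⟩, ⟨not_isAtom_ofFamily _, fun w => ?_⟩,
    ⟨haaset, fun w => ?_⟩, ⟨not_isAtom_ofFamily _, fun w => ?_⟩,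
    cardLE_of_forall_mem haa' hpa', fun heq => ?_⟩
  · exact mem_ofFamily.trans isAtom_iff.symm
  · refine (haa' w.1).trans ⟨?_, ?_⟩
    · rintro ⟨a, b, h⟩
      exact ⟨⟨_, hatom a⟩, mem_ofFamily.2 ⟨a, rfl⟩, ⟨_, hatom b⟩, mem_ofFamily.2 ⟨b, rfl⟩,
        isOrderedPair_iff.2 h⟩
    · rintro ⟨s, hs, t, ht, h⟩
      obtain ⟨a, ha⟩ := mem_ofFamily.1 hs
      obtain ⟨b, hb⟩ := mem_ofFamily.1 ht
      exact ⟨a, b, by rw [← ha, ← hb, isOrderedPair_iff.1 h]⟩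
  · refine (hpa' w.1).trans ⟨?_, ?_⟩
    · rintro ⟨a, b, hab, h⟩
      exact ⟨⟨_, hatom a⟩, mem_ofFamily.2 ⟨a, rfl⟩, ⟨_, hatom b⟩, mem_ofFamily.2 ⟨b, rfl⟩,
        fun e => hab (atom_injective (congrArg Subtype.val e)), isUnorderedPair_iff.2 h⟩
    · rintro ⟨s, hs, t, ht, hst, h⟩
      obtain ⟨a, ha⟩ := mem_ofFamily.1 hs
      obtain ⟨b, hb⟩ := mem_ofFamily.1 ht
      refine ⟨a, b, fun e => hst (Subtype.ext ?_), by rw [← ha, ← hb, isUnorderedPair_iff.1 h]⟩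
      rw [ha, hb, e]
  · -- Equality of the cardinals only has content because they are nonempty: `A × A ∈ 𝒫³(A)`.
    have hstage : aa ∈ cumul (Atom A₀) (0 + 1 + 1 + 1) := mem_cumul_succ haaset fun z hz => by
      obtain ⟨a, b, rfl⟩ := (haa' z).1 hz
      exact opair_mem_cumul (mem_cumul_zero.2 trivial) (mem_cumul_zero.2 trivial)
    obtain ⟨x, hx⟩ := cardinality_nonempty (x := (⟨aa, haa⟩ : pairModel A₀)) haaset hstage
    exact Set.disjoint_left.1 (equinumerous_disjoint haa' hpa') hx.1 (heq ▸ hx).1
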